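/- **Setting.** For each $n\in\mathbb N$ let $d=d_n$ with $d=\omega(\log n)$ as $n\to\infty$, and let $\Sigma_X=\mathrm{diag}(\sigma_X^2[1],\dots,\sigma_X^2[d])$, $\Sigma_Z=\mathrm{diag}(\sigma_Z^2[1],\dots,\sigma_Z^2[d])$ with all $\sigma_X[j],\sigma_Z[j]>0$. Let $X_i=\Sigma_X^{1/2}\tilde X_i$ and $Z_i=\Sigma_Z^{1/2}\tilde Z_i$ for $i\in[n]$, where $\tilde X_1,\dots,\tilde X_n$ are i.i.d. random vectors in $\mathbb R^d$, $\tilde Z_1,\dots,\tilde Z_n$ are i.i.d. random vectors in $\mathbb R^d$ independent of the $\tilde X_i$, both $\tilde X_1$ and $\tilde Z_1$ have independent centred coordinates, the coordinates of $\tilde X_1$ have unit variance, and $$\max_j\|\tilde X_1[j]\|_{\psi_2}\le K_X,\qquad \max_j\|\tilde Z_1[j]\|_{\psi_2}\le K_Z$$ for constants $K_X,K_Z>0$ not depending on $n$; here $\|U\|_{\psi_2}=\inf\{L>0:\mathbb E\exp(U^2/L^2)\le 2\}$. Let $\pi^\star$ be a uniformly random permutation of $[n]$, independent of $(\tilde X_i)_i$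 and $(\tilde Z_i)_i$, and let $Y_i=X_{\pi^\star(i)}+Z_i$. Except for $K_X,K_Z$, all objects (including $\Sigma_X,\Sigma_Z$ and the distributions of $\tilde X_1,\tilde Z_1$) may depend on $n$. Put $$\tilde\sigma_X^2[j]=\frac{\sigma_X^2[j]}{\sum_{k=1}^d\sigma_X^2[k]},\qquad \hat\pi_{\mathrm{LSS\text{-}C}}\in\operatorname*{arg\,min}_{\pi\in S_n}\sum_{j=1}^n\bigl\|\Sigma_Z^{-1/2}(X_{\pi(j)}-Y_j)\bigr\|_2^2,$$ where $\hat\pi_{\mathrm{LSS\text{-}C}}$ is a function of $(X_i)_i$ and $(Y_i)_i$ and ties are broken in an arbitrary way. **Theorem.** There is an absolute constant $b_{\mathrm{HD}}>0$ such that the following holds in this setting. Suppose $$\frac{\operatorname{tr}(\Sigma_Z^{-1}\Sigma_X)}{\|\Sigma_Z^{-1}\Sigma_X\|_{\mathrm{op}}}=\omega(\log n)\quad\text{as } n\to\infty,$$ and, for all sufficiently large $n$, $$b_{\mathrm{HD}}\,K_Z^2\le(\log n)^{-1}\,\frac{\sum_{j=1}^d\sigma_X^2[j]}{\Bigl(\sum_{j=1}^d\tilde\sigma_X^2[j]\,\sigma_Z^{-2}[j]\Bigr)^{-1}}.$$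 Then $\hat\pi_{\mathrm{LSS\text{-}C}}=\pi^\star$ with high probability: $\mathbb P\bigl(\#\{j\in[n]:\hat\pi_{\mathrm{LSS\text{-}C}}(j)\ne\pi^\star(j)\}=0\bigr)\to1$ as $n\to\infty$. -/

import Mathlib

open MeasureTheory ProbabilityTheory Filter Topology Asymptotics
open scoped ENNReal Nat

/-- Finite set of permutations: every set is measurable. -/
instance permMeasurableSpace (n : ℕ) : MeasurableSpace (Equiv.Perm (Fin n)) := ⊤

/-- The sub-Gaussian (`ψ₂`) norm `inf {L > 0 : 𝔼 exp (U² / L²) ≤ 2}`, equal to `∞` when no such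
`L` exists. The expectation is a Lebesgue integral with values in `[0, ∞]`. -/
noncomputable def subGaussianNorm {Ω : Type*} [MeasurableSpace Ω] (U : Ω → ℝ) (μ : Measure Ω) :
    ℝ≥0∞ :=
  ⨅ (L : ℝ) (_ : 0 < L ∧ ∫⁻ ω, ENNReal.ofReal (Real.exp (U ω ^ 2 / L ^ 2)) ∂μ ≤ 2),
    ENNReal.ofReal L

/-- The diagonal covariance matrix `Σ = diag(σ[1]², …, σ[d]²)`, with `σ[j]` the standard
deviation of coordinate `j`. -/
def covMatrix {d : ℕ} (σ : Fin d → ℝ) : Matrix (Fin d) (Fin d) ℝ :=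
  Matrix.diagonal fun j => σ j ^ 2

/-- The square root `Σ^{1/2} = diag(σ[1], …, σ[d])` of the covariance matrix (for `σ[j] > 0`). -/
def sqrtCovMatrix {d : ℕ} (σ : Fin d → ℝ) : Matrix (Fin d) (Fin d) ℝ :=
  Matrix.diagonal σ

theorem sqrtCovMatrix_mul_self {d : ℕ} (σ : Fin d → ℝ) :
    sqrtCovMatrix σ * sqrtCovMatrix σ = covMatrix σ := by
  simp [sqrtCovMatrix, covMatrix, Matrix.diagonal_mul_diagonal, sq]

theorem sqrtCovMatrix_posDef {d : ℕ} (σ : Fin d → ℝ) (hσ : ∀ j, 0 < σ j) :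
    (sqrtCovMatrix σ).PosDef :=
  Matrix.PosDef.diagonal hσ

/-- A matrix acting on Euclidean space. -/
noncomputable def matAct {d : ℕ} (A : Matrix (Fin d) (Fin d) ℝ) :
    EuclideanSpace ℝ (Fin d) →L[ℝ] EuclideanSpace ℝ (Fin d) :=
  Matrix.toEuclideanCLM (𝕜 := ℝ) A

/-- The stable rank `tr A / ‖A‖_op`, with the operator norm for the Euclidean norm. -/
noncomputable def stableRank {d : ℕ} (A : Matrix (Fin d) (Fin d) ℝ) : ℝ :=
  A.trace / ‖matAct A‖

/-- The normalized variances `σ̃²[j] = σ²[j] / ∑ k, σ²[k]`. -/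
noncomputable def normalizedVariance {d : ℕ} (σ : Fin d → ℝ) (j : Fin d) : ℝ :=
  σ j ^ 2 / ∑ k, σ k ^ 2

/-- An estimator maps the two observed point sequences `X` and `Y` to a permutation. -/
abbrev Estimator (n d : ℕ) : Type :=
  (Fin n → EuclideanSpace ℝ (Fin d)) → (Fin n → EuclideanSpace ℝ (Fin d)) → Equiv.Perm (Fin n)

/-- The covariance-adjusted sum of squares `∑ j, ‖Σ_Z^{-1/2} (x_{π(j)} - y_j)‖²`. -/
noncomputable def lsscObjective {n d : ℕ} (σZ : Fin d → ℝ)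
    (x y : Fin n → EuclideanSpace ℝ (Fin d)) (p : Equiv.Perm (Fin n)) : ℝ :=
  ∑ j, ‖matAct (sqrtCovMatrix σZ)⁻¹ (x (p j) - y j)‖ ^ 2

/-- `e` is an LSS-C estimator: its value is always a minimizer of the covariance-adjusted sum of
squares over all permutations (ties may be broken in any way). -/
def IsLSSC {n d : ℕ} (σZ : Fin d → ℝ) (e : Estimator n d) : Prop :=
  ∀ x y, ∀ p : Equiv.Perm (Fin n), lsscObjective σZ x y (e x y) ≤ lsscObjective σZ x y p

/-- The points `Σ^{1/2} U_1, …, Σ^{1/2} U_n`. -/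
noncomputable def scaledPoints {n d : ℕ} {Ω : Type*} (σ : Fin d → ℝ)
    (U : Fin n → Ω → EuclideanSpace ℝ (Fin d)) (ω : Ω) (i : Fin n) : EuclideanSpace ℝ (Fin d) :=
  matAct (sqrtCovMatrix σ) (U i ω)

/-- The observed perturbed points `Y_i = X_{π⋆(i)} + Z_i` with `X = Σ_X^{1/2} X̃` and
`Z = Σ_Z^{1/2} Z̃`. -/
noncomputable def perturbedPoints {n d : ℕ} {Ω : Type*} (σX σZ : Fin d → ℝ)
    (Xt Zt : Fin n → Ω → EuclideanSpace ℝ (Fin d)) (pstar : Ω → Equiv.Perm (Fin n))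
    (ω : Ω) (i : Fin n) : EuclideanSpace ℝ (Fin d) :=
  scaledPoints σX Xt ω (pstar ω i) + scaledPoints σZ Zt ω i

/-- `U_1, …, U_n` are i.i.d. random vectors whose coordinates are independent, centred, and have
sub-Gaussian norm at most `K`. -/
structure IsIIDSubGaussianSample {n d : ℕ} {Ω : Type*} [MeasurableSpace Ω] (μ : Measure Ω)
    (K : ℝ) (U : Fin n → Ω → EuclideanSpace ℝ (Fin d)) : Prop where
  measurable : ∀ i, Measurable (U i)
  indep : iIndepFun U μ
  identDistrib : ∀ i i', IdentDistrib (U i) (U i') μ μ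
  indep_coord : ∀ i, iIndepFun (fun (j : Fin d) ω => U i ω j) μ
  mean_zero : ∀ i j, ∫ ω, U i ω j ∂μ = 0
  subGaussian : ∀ i j, subGaussianNorm (fun ω => U i ω j) μ ≤ ENNReal.ofReal K

/-- The high-dimensional planted matching model for fixed `n` and `d`: standardized positions `Xt`,
standardized noise `Zt`, and a uniformly random hidden permutation `pstar`, all independent, with
positive coordinate standard deviations `σX`, `σZ`. The coordinates of the standardized positions
have unit variance, so that `σX[j]²` is the variance of the `j`-th coordinate of a position. -/
structure IsModelHD {n d : ℕ} {Ω : Type*} [MeasurableSpace Ω] (μ : Measure Ω)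
    (KX KZ : ℝ) (σX σZ : Fin d → ℝ) (Xt Zt : Fin n → Ω → EuclideanSpace ℝ (Fin d))
    (pstar : Ω → Equiv.Perm (Fin n)) : Prop where
  σX_pos : ∀ j, 0 < σX j
  σZ_pos : ∀ j, 0 < σZ j
  positions : IsIIDSubGaussianSample μ KX Xt
  unit_variance : ∀ i j, variance (fun ω => Xt i ω j) μ = 1
  noise : IsIIDSubGaussianSample μ KZ Zt
  indep_positions_noise : IndepFun (fun ω i => Xt i ω) (fun ω i => Zt i ω) μ
  measurable_perm : Measurable pstar
  uniform_perm : ∀ p, μ {ω | pstar ω = p} = (n ! : ℝ≥0∞)⁻¹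
  indep_perm : IndepFun pstar (fun ω => (fun i => Xt i ω, fun i => Zt i ω)) μ

/-- The events `A n` hold with high probability: `ℙ(A n) = 1 - o(1)`, stated for the complements
(for events that need not be measurable this is the stronger form). -/
def WithHighProbability {Ω : ℕ → Type*} [∀ n, MeasurableSpace (Ω n)] (μ : ∀ n, Measure (Ω n))
    (A : ∀ n, Set (Ω n)) : Prop :=
  Tendsto (fun n => μ n (A n)ᶜ) atTop (𝓝 0)

/-! Rescale coordinate `k` by `σZ k` and put `s k = σX k / σZ k`, `T = ∑ s k ^ 2 = tr(Σ_Z⁻¹ Σ_X)`.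
If `D` is the array of scaled displacements from `π⋆` to `p`, the objective at `p` exceeds that at
`π⋆` by `|D|² - 2⟨D, Z̃⟩`. An error therefore forces `|D|² ≤ 2⟨D, Z̃⟩` for some `p ≠ π⋆`; for fixed
positions this has probability at most `exp(-|D|² / (64 KZ²))`, since `⟨D, Z̃⟩` is sub-Gaussian
(`measure_sum_mul_ge`). A squared distance between two rescaled positions has mean `2T`. By a
Chernoff lower tail (`measure_sum_mul_sub_sq_le`), large stable rank makes all of them at least `T`
with high probability. Then `|D|² ≥ T · #{p ≠ π⋆}`, and the union bound over `p` is a sum of `q ^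
#{p ≠ π⋆}` with `q = exp(-T / (64 KZ²))`, at most `(1 + n q) ^ n - 1` (`sum_perm_pow_card_ne_le`).
The signal-to-noise assumption gives `q ≤ n⁻³`, so this vanishes. -/

theorem Real.exp_le_self_add_exp_sq (x : ℝ) : Real.exp x ≤ x + Real.exp (x ^ 2) := by
  have h1 := Real.add_one_le_exp (x ^ 2)
  rcases le_or_gt |x| 1 with h | h
  · have := (abs_le.1 (Real.abs_exp_sub_one_sub_id_le h)).2
    linarith
  · rcases lt_abs.1 h with h | h
    · have : Real.exp x ≤ Real.exp (x ^ 2) := Real.exp_le_exp.2 (by nlinarith)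
      linarith
    · have : Real.exp x ≤ 1 := Real.exp_le_one_iff.2 (by linarith)
      nlinarith

theorem Real.exp_neg_le_one_sub_add_sq {u : ℝ} (hu : 0 ≤ u) :
    Real.exp (-u) ≤ 1 - u + u ^ 2 := by
  rcases le_or_gt u 1 with h | h
  · have := (abs_le.1 (Real.abs_exp_sub_one_sub_id_le (x := -u) (by
      rw [abs_neg, abs_of_nonneg hu]; exact h))).2
    nlinarith
  · have : Real.exp (-u) ≤ 1 := Real.exp_le_one_iff.2 (by linarith)
    nlinarith

theorem Real.exp_mul_le_one_sub_add_mul_exp {θ : ℝ} (h0 : 0 ≤ θ) (h1 : θ ≤ 1) (v : ℝ) :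
    Real.exp (θ * v) ≤ 1 - θ + θ * Real.exp v := by
  have := convexOn_exp.2 (Set.mem_univ (0 : ℝ)) (Set.mem_univ v) (sub_nonneg.2 h1) h0 (by ring)
  simpa using this

/-! ### Moment and exponential bounds from the `ψ₂` norm. -/

section SubGaussian

variable {Ω : Type*} [MeasurableSpace Ω] {μ : Measure Ω}
  {U : Ω → ℝ} {K : ℝ}

/-- Doubling `K` leaves room for an admissible `L < 2 * K`, so the infimum need not be attained. -/
theorem lintegral_exp_sq_le_two (hK : 0 < K)
    (h : subGaussianNorm U μ ≤ ENNReal.ofReal K) :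
    ∫⁻ ω, ENNReal.ofReal (Real.exp (U ω ^ 2 / (2 * K) ^ 2)) ∂μ ≤ 2 := by
  have h2 : subGaussianNorm U μ < ENNReal.ofReal (2 * K) :=
    h.trans_lt ((ENNReal.ofReal_lt_ofReal_iff (by linarith)).2 (by linarith))
  unfold subGaussianNorm at h2
  simp only [iInf_lt_iff] at h2
  obtain ⟨L, ⟨hL, hint⟩, hlt⟩ := h2
  have hL2 : L < 2 * K := (ENNReal.ofReal_lt_ofReal_iff (by linarith)).1 hlt
  refine le_trans (lintegral_mono fun ω => ENNReal.ofReal_le_ofReal (Real.exp_le_exp.2 ?_)) hint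
  gcongr

theorem integrable_exp_sq (hU : Measurable U) (hK : 0 < K)
    (h : subGaussianNorm U μ ≤ ENNReal.ofReal K) :
    Integrable (fun ω => Real.exp (U ω ^ 2 / (2 * K) ^ 2)) μ := by
  refine ⟨by fun_prop, ?_⟩
  rw [hasFiniteIntegral_iff_ofReal (ae_of_all _ fun ω => (Real.exp_pos _).le)]
  exact (lintegral_exp_sq_le_two hK h).trans_lt (by simp)

theorem integral_exp_sq_le_two (hU : Measurable U) (hK : 0 < K)
    (h : subGaussianNorm U μ ≤ ENNReal.ofReal K) :
    ∫ ω, Real.exp (U ω ^ 2 / (2 * K) ^ 2) ∂μ ≤ 2 := by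
  rw [integral_eq_lintegral_of_nonneg_ae (ae_of_all _ fun ω => (Real.exp_pos _).le) (by fun_prop)]
  exact ENNReal.toReal_le_of_le_ofReal (by norm_num)
    (by simpa using lintegral_exp_sq_le_two hK h)

theorem integral_exp_mul_sq_le [IsProbabilityMeasure μ] (hU : Measurable U)
    (hK : 0 < K) (h : subGaussianNorm U μ ≤ ENNReal.ofReal K) {θ : ℝ} (h0 : 0 ≤ θ) (h1 : θ ≤ 1) :
    Integrable (fun ω => Real.exp (θ * (U ω ^ 2 / (2 * K) ^ 2))) μ ∧
      ∫ ω, Real.exp (θ * (U ω ^ 2 / (2 * K) ^ 2)) ∂μ ≤ 1 + θ := by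
  have hi := integrable_exp_sq hU hK h
  have hi2 : Integrable (fun ω => 1 - θ + θ * Real.exp (U ω ^ 2 / (2 * K) ^ 2)) μ :=
    (integrable_const _).add (hi.const_mul θ)
  have hle := fun ω => Real.exp_mul_le_one_sub_add_mul_exp h0 h1 (U ω ^ 2 / (2 * K) ^ 2)
  have hint : Integrable (fun ω => Real.exp (θ * (U ω ^ 2 / (2 * K) ^ 2))) μ :=
    hi2.mono' (by fun_prop) (ae_of_all _ fun ω => by
      rw [Real.norm_of_nonneg (Real.exp_pos _).le]; exact hle ω)
  refine ⟨hint, (integral_mono hint hi2 hle).trans ?_⟩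
  rw [integral_add (integrable_const _) (hi.const_mul θ), integral_const_mul]
  have := integral_exp_sq_le_two hU hK h
  simp only [integral_const, probReal_univ, smul_eq_mul, one_mul]
  nlinarith

theorem integrable_pow_four (hU : Measurable U) (hK : 0 < K)
    (h : subGaussianNorm U μ ≤ ENNReal.ofReal K) :
    Integrable (fun ω => U ω ^ 4) μ ∧ ∫ ω, U ω ^ 4 ∂μ ≤ 64 * K ^ 4 := by
  have hi := (integrable_exp_sq hU hK h).const_mul (32 * K ^ 4)
  -- With `y = U² / (2K)²` one has `U⁴ = 32 K⁴ · y² / 2`, and `y² / 2 ≤ exp y`.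
  have hle : ∀ ω, U ω ^ 4 ≤ 32 * K ^ 4 * Real.exp (U ω ^ 2 / (2 * K) ^ 2) := fun ω => by
    have hy : 0 ≤ U ω ^ 2 / (2 * K) ^ 2 := by positivity
    have h1 := Real.quadratic_le_exp_of_nonneg hy
    have h2 : U ω ^ 4 = 32 * K ^ 4 * ((U ω ^ 2 / (2 * K) ^ 2) ^ 2 / 2) := by
      field_simp; norm_num
    rw [h2]
    gcongr
    linarith
  have hint : Integrable (fun ω => U ω ^ 4) μ :=
    hi.mono' (by fun_prop) (ae_of_all _ fun ω => by
      rw [Real.norm_of_nonneg (by positivity)]; exact hle ω)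
  refine ⟨hint, (integral_mono hint hi hle).trans ?_⟩
  rw [integral_const_mul]
  have := integral_exp_sq_le_two hU hK h
  nlinarith [pow_pos hK 4]

theorem memLp_two_of_subGaussianNorm_le [IsProbabilityMeasure μ] (hU : Measurable U) (hK : 0 < K)
    (h : subGaussianNorm U μ ≤ ENNReal.ofReal K) : MemLp U 2 μ := by
  rw [memLp_two_iff_integrable_sq (by fun_prop)]
  refine ((integrable_const (1 : ℝ)).add (integrable_pow_four hU hK h).1).mono' (by fun_prop)
    (ae_of_all _ fun ω => ?_)
  rw [Real.norm_of_nonneg (by positivity)]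
  show U ω ^ 2 ≤ 1 + U ω ^ 4
  nlinarith [sq_nonneg (U ω ^ 2 - 1)]

/-- For small `t`, `exp x ≤ x + exp (x²)` isolates a linear term that integrates to zero. For large
`t`, completing the square gives `tU ≤ 2t²K² + U²/(8K²)`, and the leftover factor `exp (1/2)` is
absorbed because `1/2 < 2t²K²`. -/
theorem hasSubgaussianMGF_of_subGaussianNorm_le [IsProbabilityMeasure μ] (hU : Measurable U)
    (hK : 0 < K) (h : subGaussianNorm U μ ≤ ENNReal.ofReal K) (hmean : ∫ ω, U ω ∂μ = 0) :
    HasSubgaussianMGF U (8 * K ^ 2).toNNReal μ := by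
  have hUi : Integrable U μ := (memLp_two_of_subGaussianNorm_le hU hK h).integrable (by norm_num)
  have hhalf := integral_exp_mul_sq_le hU hK h (θ := 1 / 2) (by norm_num) (by norm_num)
  have hexp : ∀ t ω, Real.exp (t * U ω) ≤
      Real.exp (2 * t ^ 2 * K ^ 2) * Real.exp (1 / 2 * (U ω ^ 2 / (2 * K) ^ 2)) := fun t ω => by
    rw [← Real.exp_add]
    refine Real.exp_le_exp.2 ?_
    have : 2 * t ^ 2 * K ^ 2 + 1 / 2 * (U ω ^ 2 / (2 * K) ^ 2) - t * U ω
        = (2 * t * K - U ω / (2 * K)) ^ 2 / 2 := by field_simp; ring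
    nlinarith [sq_nonneg (2 * t * K - U ω / (2 * K))]
  have hint : ∀ t, Integrable (fun ω => Real.exp (t * U ω)) μ := fun t =>
    (hhalf.1.const_mul _).mono' (by fun_prop) (ae_of_all _ fun ω => by
      rw [Real.norm_of_nonneg (Real.exp_pos _).le]; exact hexp t ω)
  refine ⟨hint, fun t => ?_⟩
  rw [Real.coe_toNNReal _ (by positivity)]
  have heq : 8 * K ^ 2 * t ^ 2 / 2 = 4 * t ^ 2 * K ^ 2 := by ring
  rw [heq, mgf]
  rcases le_or_gt (4 * t ^ 2 * K ^ 2) 1 with h1 | h1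
  · have hs := integral_exp_mul_sq_le hU hK h (θ := 4 * t ^ 2 * K ^ 2) (by positivity) h1
    have hrw : ∀ ω, (t * U ω) ^ 2 = 4 * t ^ 2 * K ^ 2 * (U ω ^ 2 / (2 * K) ^ 2) := fun ω => by
      field_simp; norm_num
    calc ∫ ω, Real.exp (t * U ω) ∂μ
        ≤ ∫ ω, (t * U ω + Real.exp (4 * t ^ 2 * K ^ 2 * (U ω ^ 2 / (2 * K) ^ 2))) ∂μ :=
          integral_mono (hint t) ((hUi.const_mul t).add hs.1) fun ω => by
            have := Real.exp_le_self_add_exp_sq (t * U ω)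
            rwa [hrw] at this
      _ ≤ 1 + 4 * t ^ 2 * K ^ 2 := by
          rw [integral_add (hUi.const_mul t) hs.1, integral_const_mul, hmean]
          linarith [hs.2]
      _ ≤ _ := by linarith [Real.add_one_le_exp (4 * t ^ 2 * K ^ 2)]
  · calc ∫ ω, Real.exp (t * U ω) ∂μ
        ≤ ∫ ω, Real.exp (2 * t ^ 2 * K ^ 2) * Real.exp (1 / 2 * (U ω ^ 2 / (2 * K) ^ 2)) ∂μ :=
          integral_mono (hint t) (hhalf.1.const_mul _) (hexp t)
      _ ≤ Real.exp (2 * t ^ 2 * K ^ 2) * Real.exp (1 / 2) := by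
          rw [integral_const_mul]
          gcongr
          linarith [hhalf.2, Real.add_one_le_exp (1 / 2 : ℝ)]
      _ ≤ _ := by
          rw [← Real.exp_add]
          exact Real.exp_le_exp.2 (by linarith)

end SubGaussian

/-! ### Lower tail for the distance between two independent points. -/

section PairIndependence

variable {Ω ι : Type*} [MeasurableSpace Ω] {μ : Measure Ω} [IsProbabilityMeasure μ] [Fintype ι]

/-- Two independent families, each consisting of independent variables, form an independent family
of pairs. -/
theorem iIndepFun_prodMk {f g : ι → Ω → ℝ} (hf : ∀ i, Measurable (f i))
    (hg : ∀ i, Measurable (g i)) (hfi : iIndepFun f μ) (hgi : iIndepFun g μ)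
    (hfg : IndepFun (fun ω i => f i ω) (fun ω i => g i ω) μ) :
    iIndepFun (fun i ω => (f i ω, g i ω)) μ := by
  have hpf : ∀ i, IsProbabilityMeasure (μ.map (f i)) := fun i =>
    Measure.isProbabilityMeasure_map (hf i).aemeasurable
  have hpg : ∀ i, IsProbabilityMeasure (μ.map (g i)) := fun i =>
    Measure.isProbabilityMeasure_map (hg i).aemeasurable
  have hpair : ∀ i, μ.map (fun ω => (f i ω, g i ω)) = (μ.map (f i)).prod (μ.map (g i)) := fun i =>
    (indepFun_iff_map_prod_eq_prod_map_map (hf i).aemeasurable (hg i).aemeasurable).1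
      (hfg.comp (measurable_pi_apply i) (measurable_pi_apply i))
  rw [iIndepFun_iff_map_fun_eq_pi_map fun i => ((hf i).prodMk (hg i)).aemeasurable]
  rw [show (fun i => μ.map (fun ω => (f i ω, g i ω)))
    = fun i => (μ.map (f i)).prod (μ.map (g i)) from funext hpair]
  have hj := (indepFun_iff_map_prod_eq_prod_map_map (μ := μ)
    (measurable_pi_lambda _ hf).aemeasurable (measurable_pi_lambda _ hg).aemeasurable).1 hfg
  rw [hfi.map_fun_eq_pi_map fun i => (hf i).aemeasurable,
    hgi.map_fun_eq_pi_map fun i => (hg i).aemeasurable] at hj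
  -- The joint law is a product of two product measures; regrouping coordinates turns it into a
  -- product of pair laws.
  have hmp := (measurePreserving_arrowProdEquivProdArrow ℝ ℝ ι (fun i => μ.map (f i))
    (fun i => μ.map (g i))).symm
  rw [← hmp.map_eq, ← hj, Measure.map_map (MeasurableEquiv.measurable _)
    ((measurable_pi_lambda _ hf).prodMk (measurable_pi_lambda _ hg))]
  rfl

/-- Lower tail of a weighted sum of squared differences. -/
theorem measure_sum_mul_sub_sq_le {f g : ι → Ω → ℝ} {K M : ℝ} {w : ι → ℝ} (hK : 0 < K)
    (hw : ∀ i, 0 ≤ w i) (hM : 0 < M) (hwM : ∀ i, w i ≤ M)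
    (hf : ∀ i, Measurable (f i)) (hg : ∀ i, Measurable (g i))
    (hfi : iIndepFun f μ) (hgi : iIndepFun g μ)
    (hfg : IndepFun (fun ω i => f i ω) (fun ω i => g i ω) μ)
    (hfK : ∀ i, subGaussianNorm (f i) μ ≤ ENNReal.ofReal K)
    (hgK : ∀ i, subGaussianNorm (g i) μ ≤ ENNReal.ofReal K)
    (hf0 : ∀ i, ∫ ω, f i ω ∂μ = 0) (hg0 : ∀ i, ∫ ω, g i ω ∂μ = 0)
    (hf1 : ∀ i, variance (f i) μ = 1) (hg1 : ∀ i, variance (g i) μ = 1) :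
    μ.real {ω | ∑ i, w i * (f i ω - g i ω) ^ 2 ≤ ∑ i, w i} ≤
      Real.exp (-((∑ i, w i) / M / (4096 * K ^ 4))) := by
  -- Chosen so that `t · 1024 K⁴ · M = 1/2`, where `1024 K⁴` bounds the fourth moment of `f i - g
  -- i`. The quadratic term in the Laplace transform then costs at most a quarter of the linear term
  -- `2 t w i`, leaving `3/2 · t w i`; Chernoff at level `∑ w i` keeps `t/2 · ∑ w i`.
  set t : ℝ := 1 / (2048 * K ^ 4 * M) with ht
  have htpos : 0 < t := by positivity
  let W : ι → Ω → ℝ := fun i ω => w i * (f i ω - g i ω) ^ 2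
  have hWm : ∀ i, Measurable (W i) := fun i => by
    have := hf i; have := hg i; fun_prop
  have hWi : iIndepFun W μ :=
    (iIndepFun_prodMk hf hg hfi hgi hfg).comp (fun i p => w i * (p.1 - p.2) ^ 2)
      (fun i => by fun_prop)
  have hW0 : ∀ i ω, 0 ≤ W i ω := fun i ω => mul_nonneg (hw i) (sq_nonneg _)
  have hexpint : ∀ {V : Ω → ℝ}, Measurable V → (∀ ω, 0 ≤ V ω) →
      Integrable (fun ω => Real.exp (-t * V ω)) μ := fun hV hV0 =>
    (integrable_const (1 : ℝ)).mono' (by fun_prop) (ae_of_all _ fun ω => by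
      rw [Real.norm_of_nonneg (Real.exp_pos _).le]
      exact Real.exp_le_one_iff.2 (by nlinarith [hV0 ω]))
  have hmgf : ∀ i, mgf (W i) μ (-t) ≤ Real.exp (-(3 / 2 * t * w i)) := fun i => by
    have f2 := memLp_two_of_subGaussianNorm_le (hf i) hK (hfK i)
    have g2 := memLp_two_of_subGaussianNorm_le (hg i) hK (hgK i)
    have f4 := integrable_pow_four (hf i) hK (hfK i)
    have g4 := integrable_pow_four (hg i) hK (hgK i)
    have hind : IndepFun (f i) (g i) μ :=
      hfg.comp (measurable_pi_apply i) (measurable_pi_apply i)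
    have hd2 : MemLp (fun ω => f i ω - g i ω) 2 μ := f2.sub g2
    have hsq : ∫ ω, (f i ω - g i ω) ^ 2 ∂μ = 2 := by
      have h1 := variance_of_integral_eq_zero (X := fun ω => f i ω - g i ω) (μ := μ)
        hd2.aemeasurable (by
          rw [integral_sub (f2.integrable (by norm_num)) (g2.integrable (by norm_num)), hf0, hg0,
            sub_zero])
      have h2 := (hind.comp measurable_id measurable_neg).variance_add f2 g2.neg
      rw [variance_neg, hf1, hg1, ← sub_eq_add_neg] at h2
      rw [← h1]
      exact h2.trans (by norm_num)
    have hle4 : ∀ ω, (f i ω - g i ω) ^ 4 ≤ 8 * (f i ω ^ 4 + g i ω ^ 4) := fun ω => by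
      nlinarith [sq_nonneg (f i ω + g i ω), sq_nonneg (f i ω ^ 2 - g i ω ^ 2),
        sq_nonneg ((f i ω + g i ω) ^ 2), mul_nonneg (sq_nonneg (f i ω + g i ω))
        (sq_nonneg (f i ω - g i ω)), sq_nonneg ((f i ω - g i ω) ^ 2)]
    have hb : Integrable (fun ω => 8 * (f i ω ^ 4 + g i ω ^ 4)) μ := (f4.1.add g4.1).const_mul 8
    have hfm := hf i
    have hgm := hg i
    have hi4 : Integrable (fun ω => (f i ω - g i ω) ^ 4) μ :=
      hb.mono' (by fun_prop) (ae_of_all _ fun ω => by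
        rw [Real.norm_of_nonneg (by positivity)]; exact hle4 ω)
    have h4 : ∫ ω, (f i ω - g i ω) ^ 4 ∂μ ≤ 1024 * K ^ 4 := by
      refine (integral_mono hi4 hb hle4).trans ?_
      rw [integral_const_mul, integral_add f4.1 g4.1]
      linarith [f4.2, g4.2]
    have hi2 : Integrable (fun ω => (f i ω - g i ω) ^ 2) μ := hd2.integrable_sq
    have hbound : Integrable (fun ω => 1 - t * w i * (f i ω - g i ω) ^ 2
        + (t * w i) ^ 2 * (f i ω - g i ω) ^ 4) μ :=
      ((integrable_const _).sub (hi2.const_mul _)).add (hi4.const_mul _)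
    calc mgf (W i) μ (-t)
        ≤ ∫ ω, (1 - t * w i * (f i ω - g i ω) ^ 2
          + (t * w i) ^ 2 * (f i ω - g i ω) ^ 4) ∂μ :=
          integral_mono (hexpint (hWm i) (hW0 i)) hbound fun ω => by
            have := Real.exp_neg_le_one_sub_add_sq (mul_nonneg htpos.le (hW0 i ω))
            simp only [W] at this ⊢
            rw [neg_mul]
            refine this.trans (le_of_eq ?_)
            ring
      _ = 1 - t * w i * 2 + (t * w i) ^ 2 * ∫ ω, (f i ω - g i ω) ^ 4 ∂μ := by
          rw [integral_add (f := fun ω => 1 - t * w i * (f i ω - g i ω) ^ 2)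
            ((integrable_const _).sub (hi2.const_mul _)) (hi4.const_mul _),
            integral_sub (integrable_const _) (hi2.const_mul _), integral_const_mul,
            integral_const_mul, hsq]
          simp
      _ ≤ 1 - t * w i * 2 + (t * w i) ^ 2 * (1024 * K ^ 4) := by gcongr
      _ ≤ 1 - 3 / 2 * t * w i := by
          have : (t * w i) ^ 2 * (1024 * K ^ 4) ≤ t * w i / 2 := by
            have e1 : t * (1024 * K ^ 4) * M = 1 / 2 := by rw [ht]; field_simp; norm_num
            calc (t * w i) ^ 2 * (1024 * K ^ 4) = t * w i * (t * (1024 * K ^ 4) * w i) := by ring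
              _ ≤ t * w i * (t * (1024 * K ^ 4) * M) := by
                have := hw i
                have := hwM i
                gcongr
              _ = t * w i / 2 := by rw [e1]; ring
          linarith
      _ ≤ _ := by linarith [Real.add_one_le_exp (-(3 / 2 * t * w i))]
  have hSm : Measurable (∑ i, W i) := by
    have := Finset.measurable_sum Finset.univ fun i _ => hWm i
    simpa only [Finset.sum_fn] using this
  have hch := measure_le_le_exp_mul_mgf (X := ∑ i, W i) (μ := μ) (∑ i, w i) (t := -t)
    (by linarith) (hexpint hSm fun ω => by
      rw [Finset.sum_apply]; exact Finset.sum_nonneg fun i _ => hW0 i ω)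
  simp only [Finset.sum_apply, W] at hch
  refine hch.trans ?_
  rw [hWi.mgf_sum hWm]
  calc _ ≤ Real.exp (- -t * ∑ i, w i) * ∏ i, Real.exp (-(3 / 2 * t * w i)) := by
        gcongr with i _
        · exact fun i _ => mgf_nonneg
        · exact hmgf i
    _ = _ := by
        rw [← Real.exp_sum, ← Real.exp_add]
        congr 1
        rw [Finset.sum_neg_distrib, ← Finset.mul_sum, ht]
        field_simp
        ring

end PairIndependence

/-! ### Counting permutations by number of displaced points. -/

/-- The summand is a product over `i` of a weight depending only on `p i`. Enlarging the sum from
permutations to all functions makes it factor, each factor being at most `1 + card ι * q`. -/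
theorem sum_perm_pow_card_ne_le {ι : Type*} [Fintype ι] [DecidableEq ι] (s : Equiv.Perm ι) {q : ℝ}
    (hq : 0 ≤ q) :
    ∑ p : Equiv.Perm ι, q ^ (Finset.univ.filter fun i => p i ≠ s i).card ≤
      (1 + Fintype.card ι * q) ^ Fintype.card ι := by
  let g : ι → ι → ℝ := fun i j => if j ≠ s i then q else 1
  have hg : ∀ i j, 0 ≤ g i j := fun i j => by
    simp only [g]; split_ifs <;> positivity
  calc ∑ p : Equiv.Perm ι, q ^ (Finset.univ.filter fun i => p i ≠ s i).card
      = ∑ p : Equiv.Perm ι, ∏ i, g i (p i) := by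
        refine Finset.sum_congr rfl fun p _ => ?_
        rw [Finset.prod_ite, Finset.prod_const, Finset.prod_const_one, mul_one]
    _ = ∑ f ∈ Finset.univ.map ⟨fun p : Equiv.Perm ι => (p : ι → ι), DFunLike.coe_injective⟩,
          ∏ i, g i (f i) := by rw [Finset.sum_map]; rfl
    _ ≤ ∑ f : ι → ι, ∏ i, g i (f i) :=
        Finset.sum_le_sum_of_subset_of_nonneg (Finset.subset_univ _) fun f _ _ =>
          Finset.prod_nonneg fun i _ => hg i _
    _ = ∏ i, ∑ j, g i j := by
        rw [Finset.prod_univ_sum, Fintype.piFinset_univ]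
    _ ≤ ∏ _i : ι, (1 + Fintype.card ι * q) := by
        refine Finset.prod_le_prod (fun i _ => Finset.sum_nonneg fun j _ => hg i j) fun i _ => ?_
        calc ∑ j, g i j ≤ ∑ j, ((if j = s i then 1 else 0) + q) := by
              refine Finset.sum_le_sum fun j _ => ?_
              by_cases h : j = s i <;> simp [g, h, hq]
          _ = _ := by
              rw [Finset.sum_add_distrib]; simp
    _ = _ := by rw [Finset.prod_const, Finset.card_univ]

/-! ### Separation of the positions and confusion by the noise. -/

section Matching

variable {n d : ℕ}

/-- The squared distance of two points after scaling the coordinates by `s`. -/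
def scaledSqDist (s : Fin d → ℝ) (a b : EuclideanSpace ℝ (Fin d)) : ℝ :=
  ∑ k, s k ^ 2 * (a k - b k) ^ 2

/-- All distinct points are at scaled squared distance at least `T`. -/
def Separated (s : Fin d → ℝ) (T : ℝ) (x : Fin n → EuclideanSpace ℝ (Fin d)) : Prop :=
  ∀ i j, i ≠ j → T ≤ scaledSqDist s (x i) (x j)

/-- Twice the correlation of the noise `z` with the scaled displacements from `p₀` to `p`. -/
def noiseCorrelation (s : Fin d → ℝ) (x z : Fin n → EuclideanSpace ℝ (Fin d))
    (p₀ p : Equiv.Perm (Fin n)) : ℝ :=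
  2 * ∑ j, ∑ k, s k * (x (p j) k - x (p₀ j) k) * z j k

/-- Some permutation other than `p₀` has at most the objective value of `p₀`. -/
def Confused (s : Fin d → ℝ) (x z : Fin n → EuclideanSpace ℝ (Fin d))
    (p₀ : Equiv.Perm (Fin n)) : Prop :=
  ∃ p, p ≠ p₀ ∧ ∑ j, scaledSqDist s (x (p j)) (x (p₀ j)) ≤ noiseCorrelation s x z p₀ p

theorem measurableSet_separated (s : Fin d → ℝ) (T : ℝ) :
    MeasurableSet {x : Fin n → EuclideanSpace ℝ (Fin d) | Separated s T x} := by
  simp only [Separated, Set.ofPred_forall]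
  refine MeasurableSet.iInter fun i => MeasurableSet.iInter fun j => MeasurableSet.iInter fun _ => ?_
  unfold scaledSqDist
  exact measurableSet_le measurable_const (by fun_prop)

theorem measurableSet_confused (s : Fin d → ℝ) (p₀ : Equiv.Perm (Fin n)) :
    MeasurableSet {u : (Fin n → EuclideanSpace ℝ (Fin d)) × (Fin n → EuclideanSpace ℝ (Fin d)) |
      Confused s u.1 u.2 p₀} := by
  have hp : ∀ p : Equiv.Perm (Fin n),
      MeasurableSet {u : (Fin n → EuclideanSpace ℝ (Fin d)) × (Fin n → EuclideanSpace ℝ (Fin d)) |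
        ∑ j, scaledSqDist s (u.1 (p j)) (u.1 (p₀ j)) ≤ noiseCorrelation s u.1 u.2 p₀ p} := fun p => by
    refine measurableSet_le ?_ ?_
    · unfold scaledSqDist
      fun_prop
    · unfold noiseCorrelation
      fun_prop
  have heq : {u : (Fin n → EuclideanSpace ℝ (Fin d)) × (Fin n → EuclideanSpace ℝ (Fin d)) |
      Confused s u.1 u.2 p₀} = ⋃ p ∈ {p : Equiv.Perm (Fin n) | p ≠ p₀},
        {u | ∑ j, scaledSqDist s (u.1 (p j)) (u.1 (p₀ j)) ≤ noiseCorrelation s u.1 u.2 p₀ p} := by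
    ext u
    simp [Confused]
  rw [heq]
  exact MeasurableSet.biUnion (Set.to_countable _) fun p _ => hp p

theorem Separated.mul_card_le {s : Fin d → ℝ} {T : ℝ} {x : Fin n → EuclideanSpace ℝ (Fin d)}
    (h : Separated s T x) (p₀ p : Equiv.Perm (Fin n)) :
    (Finset.univ.filter fun j => p j ≠ p₀ j).card * T ≤
      ∑ j, scaledSqDist s (x (p j)) (x (p₀ j)) := by
  have h0 : ∀ j, 0 ≤ scaledSqDist s (x (p j)) (x (p₀ j)) := fun j =>
    Finset.sum_nonneg fun k _ => by positivity
  calc _ = ∑ j ∈ Finset.univ.filter fun j => p j ≠ p₀ j, T := by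
        rw [Finset.sum_const, nsmul_eq_mul]
    _ ≤ ∑ j ∈ Finset.univ.filter fun j => p j ≠ p₀ j, scaledSqDist s (x (p j)) (x (p₀ j)) :=
        Finset.sum_le_sum fun j hj => h _ _ (Finset.mem_filter.1 hj).2
    _ ≤ _ := Finset.sum_le_sum_of_subset_of_nonneg (Finset.filter_subset _ _) fun j _ _ => h0 j

variable {Ω : Type*} [MeasurableSpace Ω] {μ : Measure Ω} [IsProbabilityMeasure μ] {K : ℝ}
  {U : Fin n → Ω → EuclideanSpace ℝ (Fin d)}

/-- The linear form has variance proxy `8 K² ∑ D²`; its tail at `∑ D² / 2` has exponent `(∑ D² / 2)²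
/ (16 K² ∑ D²)`. -/
theorem IsIIDSubGaussianSample.measure_sum_mul_ge (hU : IsIIDSubGaussianSample μ K U) (hK : 0 < K)
    (D : Fin n → Fin d → ℝ) :
    μ.real {ω | ∑ i, ∑ k, D i k ^ 2 ≤ 2 * ∑ i, ∑ k, D i k * U i ω k} ≤
      Real.exp (-((∑ i, ∑ k, D i k ^ 2) / (64 * K ^ 2))) := by
  have hm : ∀ i k, Measurable fun ω => U i ω k := fun i k => by
    have := hU.measurable i; fun_prop
  have hrow : ∀ i, HasSubgaussianMGF (fun ω => ∑ k, D i k * U i ω k)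
      (∑ k, (D i k ^ 2 * (8 * K ^ 2)).toNNReal) μ := fun i =>
    HasSubgaussianMGF.sum_of_iIndepFun (X := fun k ω => D i k * U i ω k)
      ((hU.indep_coord i).comp (fun k u => D i k * u) fun k => by fun_prop) fun k _ => by
      rw [Real.toNNReal_mul (sq_nonneg _), Real.toNNReal_of_nonneg (sq_nonneg (D i k))]
      exact (hasSubgaussianMGF_of_subGaussianNorm_le (hm i k) hK (hU.subGaussian i k)
        (hU.mean_zero i k)).const_mul (D i k)
  have hall := HasSubgaussianMGF.sum_of_iIndepFun (μ := μ) (s := Finset.univ)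
    (X := fun i ω => ∑ k, D i k * U i ω k)
    (hU.indep.comp (fun i (u : EuclideanSpace ℝ (Fin d)) => ∑ k, D i k * u k)
      fun i => by fun_prop) fun i _ => hrow i
  have hS : 0 ≤ ∑ i, ∑ k, D i k ^ 2 := by positivity
  have := hall.measure_ge_le (ε := (∑ i, ∑ k, D i k ^ 2) / 2) (by positivity)
  have hset : {ω | ∑ i, ∑ k, D i k ^ 2 ≤ 2 * ∑ i, ∑ k, D i k * U i ω k} =
      {ω | (∑ i, ∑ k, D i k ^ 2) / 2 ≤ ∑ i, ∑ k, D i k * U i ω k} := by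
    ext ω
    simp only [Set.mem_ofPred_eq]
    constructor <;> intro h <;> linarith
  rw [hset]
  refine this.trans (Real.exp_le_exp.2 (le_of_eq ?_))
  push_cast
  simp only [Real.coe_toNNReal _ (mul_nonneg (sq_nonneg (D _ _)) (by positivity : 0 ≤ 8 * K ^ 2)),
    ← Finset.sum_mul]
  rcases hS.eq_or_lt with h | h
  -- If `D = 0`, both exponents vanish by the convention `x / 0 = 0`.
  · rw [← h]; simp
  · field_simp; norm_num

/-- Union bound for fixed positions: separation makes the cost of `p` at most `q` per displaced
point. -/
theorem IsIIDSubGaussianSample.measure_confused_le (hU : IsIIDSubGaussianSample μ K U)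
    (hK : 0 < K) {s : Fin d → ℝ} {T : ℝ} {x : Fin n → EuclideanSpace ℝ (Fin d)}
    (hx : Separated s T x) (p₀ : Equiv.Perm (Fin n)) :
    μ {ω | Confused s x (fun i => U i ω) p₀} ≤
      ENNReal.ofReal ((1 + n * Real.exp (-(T / (64 * K ^ 2)))) ^ n - 1) := by
  set q := Real.exp (-(T / (64 * K ^ 2))) with hq
  have hq0 : 0 ≤ q := (Real.exp_pos _).le
  have hone : ∀ p, μ.real {ω | ∑ j, scaledSqDist s (x (p j)) (x (p₀ j)) ≤
      noiseCorrelation s x (fun i => U i ω) p₀ p} ≤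
      q ^ (Finset.univ.filter fun i => p i ≠ p₀ i).card := fun p => by
    have h1 := hU.measure_sum_mul_ge hK fun j k => s k * (x (p j) k - x (p₀ j) k)
    have h2 := hx.mul_card_le p₀ p
    simp only [mul_pow] at h1
    refine h1.trans ?_
    rw [hq, ← Real.exp_nat_mul, mul_neg, ← mul_div_assoc]
    refine Real.exp_le_exp.2 (neg_le_neg ?_)
    gcongr
    exact h2
  have hsub : {ω | Confused s x (fun i => U i ω) p₀} ⊆
      ⋃ p ∈ Finset.univ.erase p₀, {ω | ∑ j, scaledSqDist s (x (p j)) (x (p₀ j)) ≤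
      noiseCorrelation s x (fun i => U i ω) p₀ p} := fun ω ⟨p, hp, h⟩ =>
    Set.mem_biUnion (Finset.mem_coe.2 (Finset.mem_erase.2 ⟨hp, Finset.mem_univ _⟩)) h
  refine (measure_mono hsub).trans ((measure_biUnion_finset_le _ _).trans ?_)
  calc _ ≤ ∑ p ∈ Finset.univ.erase p₀,
        ENNReal.ofReal (q ^ (Finset.univ.filter fun i => p i ≠ p₀ i).card) :=
        Finset.sum_le_sum fun p _ => by
          rw [← ofReal_measureReal]
          exact ENNReal.ofReal_le_ofReal (hone p)
    _ = ENNReal.ofReal (∑ p ∈ Finset.univ.erase p₀,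
          q ^ (Finset.univ.filter fun i => p i ≠ p₀ i).card) :=
        (ENNReal.ofReal_sum_of_nonneg fun p _ => by positivity).symm
    _ ≤ _ := by
        refine ENNReal.ofReal_le_ofReal ?_
        have h := sum_perm_pow_card_ne_le p₀ hq0
        -- The term at `p₀` is `q ^ 0 = 1`, which accounts for the `- 1`.
        rw [← Finset.add_sum_erase _ _ (Finset.mem_univ p₀)] at h
        simp only [Fintype.card_fin] at h
        simp only [ne_eq, not_true_eq_false, Finset.filter_false, Finset.card_empty, pow_zero] at h
        linarith

/-- The threshold is half the mean squared distance, so the lower tail applies to each pair; the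
factor `n ^ 2` counts ordered pairs. -/
theorem IsIIDSubGaussianSample.measure_not_separated_le (hU : IsIIDSubGaussianSample μ K U)
    (hK : 0 < K) (hvar : ∀ i j, variance (fun ω => U i ω j) μ = 1) {s : Fin d → ℝ} {M : ℝ}
    (hM : 0 < M) (hsM : ∀ k, s k ^ 2 ≤ M) :
    μ {ω | ¬ Separated s (∑ k, s k ^ 2) fun i => U i ω} ≤
      ENNReal.ofReal (n ^ 2 * Real.exp (-((∑ k, s k ^ 2) / M / (4096 * K ^ 4)))) := by
  have hm : ∀ i k, Measurable fun ω => U i ω k := fun i k => by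
    have := hU.measurable i; fun_prop
  let A : Fin n × Fin n → Set Ω := fun ij =>
    {ω | ij.1 ≠ ij.2 ∧ scaledSqDist s (U ij.1 ω) (U ij.2 ω) ≤ ∑ k, s k ^ 2}
  have hsub : {ω | ¬ Separated s (∑ k, s k ^ 2) fun i => U i ω} ⊆
      ⋃ ij ∈ (Finset.univ : Finset (Fin n × Fin n)), A ij := fun ω hω => by
    simp only [Separated, Set.mem_ofPred_eq, not_forall, not_le] at hω
    obtain ⟨i, j, hij, h⟩ := hω
    exact Set.mem_biUnion (Finset.mem_coe.2 (Finset.mem_univ (i, j))) ⟨hij, h.le⟩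
  have hA : ∀ ij, μ (A ij) ≤
      ENNReal.ofReal (Real.exp (-((∑ k, s k ^ 2) / M / (4096 * K ^ 4)))) := fun ⟨i, j⟩ => by
    by_cases hij : i = j
    · simp [A, hij]
    · have hind : IndepFun (fun ω k => U i ω k) (fun ω k => U j ω k) μ :=
        (hU.indep.indepFun hij).comp
          (by fun_prop : Measurable fun (u : EuclideanSpace ℝ (Fin d)) k => u k)
          (by fun_prop : Measurable fun (u : EuclideanSpace ℝ (Fin d)) k => u k)
      have := measure_sum_mul_sub_sq_le (μ := μ) (f := fun k ω => U i ω k)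
        (g := fun k ω => U j ω k) (w := fun k => s k ^ 2) hK (fun k => sq_nonneg _) hM hsM
        (hm i) (hm j) (hU.indep_coord i) (hU.indep_coord j) hind (hU.subGaussian i)
        (hU.subGaussian j) (hU.mean_zero i) (hU.mean_zero j) (hvar i) (hvar j)
      have hA : A (i, j) ⊆ {ω | ∑ k, s k ^ 2 * (U i ω k - U j ω k) ^ 2 ≤ ∑ k, s k ^ 2} :=
        fun ω hω => hω.2
      refine (measure_mono hA).trans ?_
      rw [← ofReal_measureReal]
      exact ENNReal.ofReal_le_ofReal this
  refine (measure_mono hsub).trans ((measure_biUnion_finset_le _ _).trans ?_)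
  refine (Finset.sum_le_sum fun ij _ => hA ij).trans (le_of_eq ?_)
  rw [Finset.sum_const, Finset.card_univ, Fintype.card_prod, Fintype.card_fin, nsmul_eq_mul,
    ENNReal.ofReal_mul (by positivity), ← Nat.cast_pow, ENNReal.ofReal_natCast, sq]

/-- By independence and Fubini, `V` may be frozen at a separated configuration, where the
fixed-position bound is uniform. -/
theorem measure_separated_and_confused_le {V : Fin n → Ω → EuclideanSpace ℝ (Fin d)}
    (hU : IsIIDSubGaussianSample μ K U) (hK : 0 < K) (hV : ∀ i, Measurable (V i))
    (hVU : IndepFun (fun ω i => V i ω) (fun ω i => U i ω) μ) (s : Fin d → ℝ) (T : ℝ)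
    (p₀ : Equiv.Perm (Fin n)) :
    μ {ω | Separated s T (fun i => V i ω) ∧ Confused s (fun i => V i ω) (fun i => U i ω) p₀} ≤
      ENNReal.ofReal ((1 + n * Real.exp (-(T / (64 * K ^ 2)))) ^ n - 1) := by
  have hVm : Measurable fun ω i => V i ω := measurable_pi_lambda _ hV
  have hUm : Measurable fun ω i => U i ω := measurable_pi_lambda _ hU.measurable
  have hlaw := (indepFun_iff_map_prod_eq_prod_map_map hVm.aemeasurable hUm.aemeasurable).1 hVU
  have hpV : IsProbabilityMeasure (μ.map fun ω i => V i ω) :=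
    Measure.isProbabilityMeasure_map hVm.aemeasurable
  have hpU : IsProbabilityMeasure (μ.map fun ω i => U i ω) :=
    Measure.isProbabilityMeasure_map hUm.aemeasurable
  let B : Set ((Fin n → EuclideanSpace ℝ (Fin d)) × (Fin n → EuclideanSpace ℝ (Fin d))) :=
    {u | Separated s T u.1 ∧ Confused s u.1 u.2 p₀}
  have hB : MeasurableSet B :=
    (measurable_fst (measurableSet_separated s T)).inter (measurableSet_confused s p₀)
  have h1 : μ {ω | Separated s T (fun i => V i ω) ∧
      Confused s (fun i => V i ω) (fun i => U i ω) p₀} =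
      (μ.map fun ω => ((fun i => V i ω), fun i => U i ω)) B :=
    (Measure.map_apply (hVm.prodMk hUm) hB).symm
  rw [h1, hlaw, Measure.prod_apply hB]
  calc _ ≤ ∫⁻ _, ENNReal.ofReal ((1 + n * Real.exp (-(T / (64 * K ^ 2)))) ^ n - 1)
        ∂(μ.map fun ω i => V i ω) := lintegral_mono fun x => ?_
    _ = _ := by simp
  rw [Measure.map_apply hUm (measurable_prodMk_left hB)]
  by_cases hx : Separated s T x
  · exact (measure_mono fun ω hω => hω.2).trans (hU.measure_confused_le hK hx p₀)
  · have : (fun ω i => U i ω) ⁻¹' (Prod.mk x ⁻¹' B) = ∅ :=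
      Set.eq_empty_of_forall_notMem fun ω hω => hx hω.1
    rw [this]; simp

end Matching

/-! ### Diagonal matrices and the algebra of the objective. -/

section Deterministic

variable {n d : ℕ}

theorem matAct_diagonal_apply (v : Fin d → ℝ) (x : EuclideanSpace ℝ (Fin d)) (k : Fin d) :
    matAct (Matrix.diagonal v) x k = v k * x k := by
  simp [matAct, Matrix.mulVec_diagonal]

theorem diagonal_inv_of_pos {v : Fin d → ℝ} (hv : ∀ k, 0 < v k) :
    (Matrix.diagonal v)⁻¹ = Matrix.diagonal fun k => (v k)⁻¹ := by
  refine Matrix.inv_eq_right_inv ?_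
  rw [Matrix.diagonal_mul_diagonal, ← Matrix.diagonal_one]
  congr 1
  ext k
  exact mul_inv_cancel₀ (hv k).ne'

theorem abs_le_norm_matAct_diagonal (v : Fin d → ℝ) (k : Fin d) :
    |v k| ≤ ‖matAct (Matrix.diagonal v)‖ := by
  have h := (matAct (Matrix.diagonal v)).le_opNorm (EuclideanSpace.single k 1)
  have h2 := PiLp.norm_apply_le (matAct (Matrix.diagonal v) (EuclideanSpace.single k 1)) k
  rw [matAct_diagonal_apply] at h2
  simp at h h2
  exact h2.trans h

theorem inv_covMatrix_mul_covMatrix {σX σZ : Fin d → ℝ} (hZ : ∀ k, 0 < σZ k) :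
    (covMatrix σZ)⁻¹ * covMatrix σX = Matrix.diagonal fun k => (σX k / σZ k) ^ 2 := by
  unfold covMatrix
  rw [diagonal_inv_of_pos fun k => pow_pos (hZ k) 2, Matrix.diagonal_mul_diagonal]
  congr 1
  ext k
  field_simp

theorem stableRank_inv_covMatrix_mul {σX σZ : Fin d → ℝ} (hZ : ∀ k, 0 < σZ k) :
    stableRank ((covMatrix σZ)⁻¹ * covMatrix σX) =
      (∑ k, (σX k / σZ k) ^ 2) / ‖matAct ((covMatrix σZ)⁻¹ * covMatrix σX)‖ := by
  unfold stableRank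
  congr 1
  rw [inv_covMatrix_mul_covMatrix hZ, Matrix.trace_diagonal]

/-- Identifies the signal-to-noise ratio with the trace `T`, so that both assumptions of the theorem
speak about `T`. -/
theorem sum_sq_div_inv_sum_normalizedVariance {σX : Fin d → ℝ} (σZ : Fin d → ℝ)
    (hX : ∀ k, 0 < σX k) :
    (∑ j, σX j ^ 2) / (∑ j, normalizedVariance σX j * (σZ j ^ 2)⁻¹)⁻¹ =
      ∑ k, (σX k / σZ k) ^ 2 := by
  rw [div_inv_eq_mul, Finset.mul_sum]
  refine Finset.sum_congr rfl fun k _ => ?_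
  have hS : 0 < ∑ j, σX j ^ 2 :=
    Finset.sum_pos (fun j _ => pow_pos (hX j) 2) ⟨k, Finset.mem_univ k⟩
  rw [normalizedVariance, div_pow, ← mul_assoc, mul_div_cancel₀ _ hS.ne', div_eq_mul_inv]

theorem lsscObjective_eq {σX σZ : Fin d → ℝ} (hZ : ∀ k, 0 < σZ k) {Ω : Type*}
    (Xt Zt : Fin n → Ω → EuclideanSpace ℝ (Fin d)) (pstar : Ω → Equiv.Perm (Fin n)) (ω : Ω)
    (p : Equiv.Perm (Fin n)) :
    lsscObjective σZ (scaledPoints σX Xt ω) (perturbedPoints σX σZ Xt Zt pstar ω) p =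
      ∑ j, ∑ k, (σX k / σZ k * (Xt (p j) ω k - Xt (pstar ω j) ω k) - Zt j ω k) ^ 2 := by
  unfold lsscObjective
  refine Finset.sum_congr rfl fun j _ => ?_
  rw [EuclideanSpace.norm_sq_eq]
  refine Finset.sum_congr rfl fun k _ => ?_
  rw [Real.norm_eq_abs, sq_abs, sqrtCovMatrix, diagonal_inv_of_pos hZ, matAct_diagonal_apply]
  simp only [scaledPoints, perturbedPoints, PiLp.sub_apply, PiLp.add_apply, sqrtCovMatrix,
    matAct_diagonal_apply]
  congr 1
  have := (hZ k).ne'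
  field_simp
  ring

/-- At `pstar ω` the displacement vanishes and the objective is the pure noise energy; expanding the
square at the minimizer and cancelling that energy leaves the confusion inequality. -/
theorem IsLSSC.confused_of_ne {σX σZ : Fin d → ℝ} (hZ : ∀ k, 0 < σZ k) {e : Estimator n d}
    (he : IsLSSC σZ e) {Ω : Type*} {Xt Zt : Fin n → Ω → EuclideanSpace ℝ (Fin d)}
    {pstar : Ω → Equiv.Perm (Fin n)} {ω : Ω}
    (hne : e (scaledPoints σX Xt ω) (perturbedPoints σX σZ Xt Zt pstar ω) ≠ pstar ω) :
    Confused (fun k => σX k / σZ k) (fun i => Xt i ω) (fun i => Zt i ω) (pstar ω) := by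
  refine ⟨_, hne, ?_⟩
  have h := he (scaledPoints σX Xt ω) (perturbedPoints σX σZ Xt Zt pstar ω) (pstar ω)
  rw [lsscObjective_eq hZ, lsscObjective_eq hZ] at h
  set p := e (scaledPoints σX Xt ω) (perturbedPoints σX σZ Xt Zt pstar ω)
  unfold scaledSqDist noiseCorrelation
  rw [← sub_nonneg, ← Finset.sum_sub_distrib] at h
  rw [← sub_nonneg, Finset.mul_sum, ← Finset.sum_sub_distrib]
  refine h.trans_eq (Finset.sum_congr rfl fun j _ => ?_)
  rw [Finset.mul_sum, ← Finset.sum_sub_distrib, ← Finset.sum_sub_distrib]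
  refine Finset.sum_congr rfl fun k _ => ?_
  ring

end Deterministic

/-! ### Averaging over the hidden permutation, and the limit. -/

/-- Error bound of the LSS-C estimator for a fixed number of points. -/
theorem IsModelHD.measure_lssc_ne_le {n d : ℕ} {Ω : Type*} [MeasurableSpace Ω] {μ : Measure Ω}
    [IsProbabilityMeasure μ] {KX KZ : ℝ} {σX σZ : Fin d → ℝ}
    {Xt Zt : Fin n → Ω → EuclideanSpace ℝ (Fin d)} {pstar : Ω → Equiv.Perm (Fin n)}
    (h : IsModelHD μ KX KZ σX σZ Xt Zt pstar) (hKX : 0 < KX) (hKZ : 0 < KZ) {e : Estimator n d}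
    (he : IsLSSC σZ e) {M : ℝ} (hM : 0 < M) (hsM : ∀ k, (σX k / σZ k) ^ 2 ≤ M) :
    μ {ω | e (scaledPoints σX Xt ω) (perturbedPoints σX σZ Xt Zt pstar ω) ≠ pstar ω} ≤
      ENNReal.ofReal
          (n ^ 2 * Real.exp (-((∑ k, (σX k / σZ k) ^ 2) / M / (4096 * KX ^ 4)))) +
        ENNReal.ofReal
          ((1 + n * Real.exp (-((∑ k, (σX k / σZ k) ^ 2) / (64 * KZ ^ 2)))) ^ n - 1) := by
  set s : Fin d → ℝ := fun k => σX k / σZ k with hs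
  set T : ℝ := ∑ k, s k ^ 2 with hT
  let B : Equiv.Perm (Fin n) →
      Set ((Fin n → EuclideanSpace ℝ (Fin d)) × (Fin n → EuclideanSpace ℝ (Fin d))) := fun p₀ =>
    {u | Separated s T u.1} ∩ {u | Confused s u.1 u.2 p₀}
  have hB : ∀ p₀, MeasurableSet (B p₀) := fun p₀ =>
    (measurable_fst (measurableSet_separated s T)).inter (measurableSet_confused s p₀)
  -- The estimator need not be measurable, so its failure event is covered by measurable events in
  -- which `pstar` is fixed to `p₀`.
  have hsub : {ω | e (scaledPoints σX Xt ω) (perturbedPoints σX σZ Xt Zt pstar ω) ≠ pstar ω} ⊆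
      {ω | ¬ Separated s T fun i => Xt i ω} ∪ ⋃ p₀ ∈ (Finset.univ : Finset (Equiv.Perm (Fin n))),
        (pstar ⁻¹' {p₀} ∩ (fun ω => (fun i => Xt i ω, fun i => Zt i ω)) ⁻¹' B p₀) := by
    intro ω hω
    have hc := he.confused_of_ne h.σZ_pos hω
    by_cases hsep : Separated s T fun i => Xt i ω
    · exact Or.inr (Set.mem_biUnion (Finset.mem_coe.2 (Finset.mem_univ (pstar ω)))
        ⟨rfl, hsep, hc⟩)
    · exact Or.inl hsep
  refine (measure_mono hsub).trans ((measure_union_le _ _).trans (add_le_add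
    (h.positions.measure_not_separated_le hKX h.unit_variance hM hsM) ?_))
  refine (measure_biUnion_finset_le _ _).trans ?_
  calc _ ≤ ∑ _p₀ : Equiv.Perm (Fin n), (n ! : ℝ≥0∞)⁻¹ *
        ENNReal.ofReal ((1 + n * Real.exp (-(T / (64 * KZ ^ 2)))) ^ n - 1) := by
        refine Finset.sum_le_sum fun p₀ _ => ?_
        -- Independence gives each of the `n !` values weight `1 / n !`, so the union over `p₀`
        -- costs nothing.
        rw [h.indep_perm.measure_inter_preimage_eq_mul _ _ trivial (hB p₀)]
        exact mul_le_mul' (h.uniform_perm p₀).le (measure_separated_and_confused_le h.noise hKZ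
          h.positions.measurable h.indep_positions_noise s T p₀)
    _ = _ := by
        rw [Finset.sum_const, Finset.card_univ, Fintype.card_perm, Fintype.card_fin, nsmul_eq_mul,
          ← mul_assoc, ENNReal.mul_inv_cancel (by simp [Nat.factorial_ne_zero]) (by simp), one_mul]

theorem Real.exp_neg_le_inv_pow_three {n : ℕ} (hn : 0 < n) {a : ℝ} (ha : 3 * Real.log n ≤ a) :
    Real.exp (-a) ≤ ((n : ℝ) ^ 3)⁻¹ := by
  have hn' : (0 : ℝ) < n := Nat.cast_pos.2 hn
  calc Real.exp (-a) ≤ Real.exp (-(3 * Real.log n)) := Real.exp_le_exp.2 (neg_le_neg ha)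
    _ = _ := by
      rw [Real.exp_neg, show 3 * Real.log n = ((3 : ℕ) : ℝ) * Real.log n by norm_num,
        Real.exp_nat_mul, Real.exp_log hn']

theorem theorem1p5 :
    ∃ b : ℝ, 0 < b ∧
      ∀ (KX KZ : ℝ), 0 < KX → 0 < KZ →
      ∀ (d : ℕ → ℕ)
        (Ω : ℕ → Type*) [∀ n, MeasurableSpace (Ω n)]
        (μ : ∀ n, Measure (Ω n)) [∀ n, IsProbabilityMeasure (μ n)]
        (σX σZ : ∀ n, Fin (d n) → ℝ)
        (Xt Zt : ∀ n, Fin n → Ω n → EuclideanSpace ℝ (Fin (d n)))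
        (pstar : ∀ n, Ω n → Equiv.Perm (Fin n))
        (phat : ∀ n, Estimator n (d n)),
        (∀ n, IsModelHD (μ n) KX KZ (σX n) (σZ n) (Xt n) (Zt n) (pstar n)) →
        (fun n : ℕ => Real.log n) =o[atTop] (fun n => (d n : ℝ)) →
        (fun n : ℕ => Real.log n) =o[atTop]
          (fun n => stableRank ((covMatrix (σZ n))⁻¹ * covMatrix (σX n))) →
        (∀ᶠ n : ℕ in atTop,
          b * KZ ^ 2 ≤ (Real.log n)⁻¹ *
            ((∑ j, σX n j ^ 2) /
              (∑ j, normalizedVariance (σX n) j * (σZ n j ^ 2)⁻¹)⁻¹)) →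
        (∀ n, IsLSSC (σZ n) (phat n)) →
        WithHighProbability μ fun n =>
          {ω | hammingDist
            (phat n (scaledPoints (σX n) (Xt n) ω)
              (perturbedPoints (σX n) (σZ n) (Xt n) (Zt n) (pstar n) ω))
            (pstar n ω) = 0} := by
  -- `192 = 3 · 64` yields `3 log n ≤ T / (64 KZ²)`, hence `q ≤ n⁻³`.
  refine ⟨192, by norm_num, ?_⟩
  intro KX KZ hKX hKZ d Ω _ μ _ σX σZ Xt Zt pstar phat hmodel _ hrank hsnr hlssc
  have hlim : Tendsto (fun n : ℕ => ENNReal.ofReal ((n : ℝ)⁻¹)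
      + ENNReal.ofReal (Real.exp ((n : ℝ)⁻¹) - 1)) atTop (𝓝 0) := by
    have h0 : Tendsto (fun n : ℕ => (n : ℝ)⁻¹) atTop (𝓝 0) := tendsto_inv_atTop_nhds_zero_nat
    have h1 := ENNReal.tendsto_ofReal h0
    have h2 := ENNReal.tendsto_ofReal (((Real.continuous_exp.tendsto 0).comp h0).sub_const 1)
    simpa using h1.add h2
  refine tendsto_of_tendsto_of_tendsto_of_le_of_le' tendsto_const_nhds hlim
    (Eventually.of_forall fun n => zero_le) ?_
  -- `12288 = 3 · 4096` makes each pair fail separation with probability at most `n⁻³`, against `n²`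
  -- pairs.
  filter_upwards [hrank.bound (show (0 : ℝ) < 1 / (12288 * KX ^ 4) by positivity), hsnr,
    eventually_ge_atTop 2] with n hr hT hn
  have hn0 : (0 : ℝ) < n := by positivity
  have hlog : 0 < Real.log n := Real.log_pos (by exact_mod_cast hn)
  have hm := hmodel n
  have hZ := hm.σZ_pos
  rw [sum_sq_div_inv_sum_normalizedVariance _ hm.σX_pos] at hT
  rw [stableRank_inv_covMatrix_mul hZ] at hr
  set M := ‖matAct ((covMatrix (σZ n))⁻¹ * covMatrix (σX n))‖ with hMdef
  set T := ∑ k, (σX n k / σZ n k) ^ 2 with hTdef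
  have hT0 : 0 ≤ T := Finset.sum_nonneg fun k _ => sq_nonneg _
  have hM0 : 0 ≤ M := norm_nonneg _
  rw [Real.norm_of_nonneg hlog.le, Real.norm_of_nonneg (div_nonneg hT0 hM0)] at hr
  -- If `M = 0`, the stable rank is `0` by convention, contradicting `hr` since `log n > 0`.
  have hM : 0 < M := hM0.lt_of_ne fun h => by
    rw [← h, div_zero, mul_zero] at hr
    linarith
  have hsM : ∀ k, (σX n k / σZ n k) ^ 2 ≤ M := fun k => by
    rw [hMdef, inv_covMatrix_mul_covMatrix hZ]
    exact (le_abs_self _).trans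
      (abs_le_norm_matAct_diagonal (fun k => (σX n k / σZ n k) ^ 2) k)
  have hset : {ω | hammingDist
      (phat n (scaledPoints (σX n) (Xt n) ω)
        (perturbedPoints (σX n) (σZ n) (Xt n) (Zt n) (pstar n) ω)) (pstar n ω) = 0}ᶜ =
      {ω | phat n (scaledPoints (σX n) (Xt n) ω)
        (perturbedPoints (σX n) (σZ n) (Xt n) (Zt n) (pstar n) ω) ≠ pstar n ω} := by
    ext ω
    simp [hammingDist_eq_zero]
  rw [hset]
  refine (hm.measure_lssc_ne_le hKX hKZ (hlssc n) hM hsM).trans (add_le_add ?_ ?_) <;>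
    refine ENNReal.ofReal_le_ofReal ?_
  · have h3 : 3 * Real.log n ≤ T / M / (4096 * KX ^ 4) := by
      rw [le_div_iff₀ (by positivity)]
      rw [one_div_mul_eq_div, le_div_iff₀ (by positivity)] at hr
      linarith
    calc (n : ℝ) ^ 2 * Real.exp (-(T / M / (4096 * KX ^ 4)))
        ≤ (n : ℝ) ^ 2 * ((n : ℝ) ^ 3)⁻¹ := by
          gcongr
          exact Real.exp_neg_le_inv_pow_three (by omega) h3
      _ = (n : ℝ)⁻¹ := by field_simp
  · have h3 : 3 * Real.log n ≤ T / (64 * KZ ^ 2) := by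
      rw [le_div_iff₀ (by positivity)]
      rw [inv_mul_eq_div, le_div_iff₀ hlog] at hT
      linarith
    calc (1 + n * Real.exp (-(T / (64 * KZ ^ 2)))) ^ n - 1
        ≤ (1 + n * ((n : ℝ) ^ 3)⁻¹) ^ n - 1 := by
          gcongr
          exact Real.exp_neg_le_inv_pow_three (by omega) h3
      _ ≤ Real.exp (((n : ℝ) ^ 2)⁻¹) ^ n - 1 := by
          gcongr
          rw [show (n : ℝ) * ((n : ℝ) ^ 3)⁻¹ = ((n : ℝ) ^ 2)⁻¹ by field_simp, add_comm]
          exact Real.add_one_le_exp _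
      _ = Real.exp ((n : ℝ)⁻¹) - 1 := by
          rw [← Real.exp_nat_mul]
          congr 2
          field_simp
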